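/- For an integer $k\ge 1$, let $GP(3k,k)$ be the generalised Petersen graph: the simple graph on the vertex set $\{u_i,v_i : i\in\mathbb Z_{3k}\}$ with edge set $\{u_iu_{i+1},\ u_iv_i,\ v_iv_{i+k} : i\in\mathbb Z_{3k}\}$. An edge colouring assigns a colour to each edge so that any two distinct edges sharing an endvertex receive distinct colours. The chromatic index is the smallest number of colours in an edge colouring. The choice index is the smallest $\ell$ such that, for every assignment of a list $L_e$ of exactly $\ell$ allowed colours to each edge $e$, there is an edge colouring in which every edge $e$ receives a colour from $L_e$. Theorem. For every $k\ge 1$, the list-edge-colouring conjecture holds for $GP(3k,k)$: its choice index equals its chromatic index, and both are equal to $3$. -/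

import Mathlib

namespace SimpleGraph

universe u

/-- The generalised Petersen graph `GP(n, k)` (for `1 ≤ k < n / 2`): the vertices are `u i = inl i`
and `v i = inr i` for `i ∈ ℤ/nℤ`, the edges are `u i u (i+1)`, `u i v i` and `v i v (i+k)`. -/
def generalizedPetersen (n k : ℕ) : SimpleGraph (ZMod n ⊕ ZMod n) :=
  fromEdgeSet {e | ∃ i : ZMod n,
    e = s(Sum.inl i, Sum.inl (i + 1)) ∨
    e = s(Sum.inl i, Sum.inr i) ∨
    e = s(Sum.inr i, Sum.inr (i + (k : ZMod n)))}

/-- The chromatic index: the least number of colours in an edge colouring, that is, in a colouring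
of the edges in which distinct edges sharing an endvertex receive distinct colours
(`⊤` if no finite number suffices). -/
noncomputable def chromaticIndex {V : Type u} (G : SimpleGraph V) : ℕ∞ :=
  G.lineGraph.chromaticNumber

/-- Whenever every edge `e` is given a list `L e` of exactly `l` allowed colours (from any set `C`
of colours), there is an edge colouring in which every edge has a colour from its list. -/
def EdgeChoosable {V : Type u} (G : SimpleGraph V) (l : ℕ) : Prop :=
  ∀ (C : Type u) (L : G.edgeSet → Finset C), (∀ e, (L e).card = l) →
    ∃ c : G.lineGraph.Coloring C, ∀ e, c e ∈ L e

/-- The choice index: the least `l` such that all assignments of lists of size `l` to the edges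
allow a list edge-colouring (`⊤` if there is no such `l`). -/
noncomputable def choiceIndex {V : Type u} (G : SimpleGraph V) : ℕ∞ :=
  ⨅ l ∈ {l : ℕ | G.EdgeChoosable l}, (l : ℕ∞)

end SimpleGraph

/-! The proof is by the Alon–Tarsi method. The graph polynomial of the line graph has one
Vandermonde factor per vertex, so its degree is at most twice the number of edges. By the
combinatorial Nullstellensatz, lists of size 3 suffice once the coefficient of `∏ X e ^ 2` is
nonzero.

That coefficient is a weighted sum of values on `{0, 1, 2} ^ σ`. Only proper 3-edge-colourings
contribute. Each of them uses colour 1 once at every vertex, so all have the same weight, and the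
coefficient is a nonzero multiple of the signed number of 3-edge-colourings.

The signed number is computed by transfer matrices. Column `j` consists of the vertices with indices
`j`, `j + k`, `j + 2k`. Its inner triangle acts as a single vertex up to sign (`sum_triangle`), so
the column contributes `-T`, with `T = strandTransfer`. After `k` columns the three strands close up
with a cyclic shift `P`, so the count is, up to sign, a trace of `T ^ k` twisted by `P`. Since `T ^
3 = -3 T` (`strandTransfer_pow_three`), this trace is a power of `-3` times its value `-6` at `k =
1` or `24` at `k = 2`, hence never zero. -/

open Finset

/-! ### Coefficient extraction on a grid and the combinatorial Nullstellensatz -/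

section Nullstellensatz

open MvPolynomial

/-- The weights of the linear functional on functions on `{0, 1, 2}` that takes a polynomial of
degree at most `2` to its leading coefficient. -/
def leadingWeight (v : Fin 3) : ℚ := (1 / 2) * (-2) ^ (if v = 1 then 1 else 0)

lemma sum_leadingWeight_mul_pow {m : ℕ} (hm : m ≤ 2) :
    ∑ v : Fin 3, leadingWeight v * ((v : ℕ) : ℚ) ^ m = if m = 2 then 1 else 0 := by
  have h : (2 : Fin 3) ≠ 1 := by decide
  interval_cases m <;> norm_num [Fin.sum_univ_three, leadingWeight, h]

variable {σ : Type*} [Fintype σ]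

/-- The sum factors over the coordinates. Under the degree bound, an exponent vector other than the
constant 2 has an entry below 2, and the factor there vanishes. -/
lemma sum_prod_leadingWeight_mul_pow [DecidableEq σ] (d : σ →₀ ℕ)
    (hd : d.degree ≤ 2 * Fintype.card σ) :
    ∑ x : σ → Fin 3, ∏ e, leadingWeight (x e) * ((x e : ℕ) : ℚ) ^ d e =
      if d = Finsupp.equivFunOnFinite.symm (fun _ => 2) then 1 else 0 := by
  rw [← Fintype.piFinset_univ,
    ← Finset.prod_univ_sum (fun _ : σ => (univ : Finset (Fin 3)))
      (fun e v => leadingWeight v * ((v : ℕ) : ℚ) ^ d e)]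
  split_ifs with h
  · subst h
    exact Finset.prod_eq_one fun e _ => by simpa using sum_leadingWeight_mul_pow le_rfl
  · obtain ⟨e, he⟩ : ∃ e, d e < 2 := by
      by_contra! hge
      apply h
      have hsum : ∑ e, d e ≤ ∑ _e : σ, 2 := by
        rw [← Finsupp.degree_eq_sum]
        simpa [mul_comm] using hd
      ext e
      have := (Finset.sum_eq_sum_iff_of_le (fun e _ => hge e)).1
        (le_antisymm (Finset.sum_le_sum fun e _ => hge e) hsum) e (mem_univ e)
      simpa using this.symm
    refine Finset.prod_eq_zero (mem_univ e) ?_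
    rw [sum_leadingWeight_mul_pow he.le, if_neg he.ne]

/-- The coefficient of `∏ X e ^ 2` in a polynomial of degree at most `2 |σ|`, as a weighted sum of
its values on the grid `{0, 1, 2} ^ σ`. -/
lemma sum_grid_eq_coeff [DecidableEq σ] (f : MvPolynomial σ ℚ)
    (hf : f.totalDegree ≤ 2 * Fintype.card σ) :
    ∑ x : σ → Fin 3, (∏ e, leadingWeight (x e)) * eval (fun e => ((x e : ℕ) : ℚ)) f =
      f.coeff (Finsupp.equivFunOnFinite.symm fun _ => 2) := by
  simp_rw [eval_eq', Finset.mul_sum]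
  rw [Finset.sum_comm]
  have key : ∀ d ∈ f.support, (∑ x : σ → Fin 3, (∏ e, leadingWeight (x e)) *
      (f.coeff d * ∏ e, ((x e : ℕ) : ℚ) ^ d e)) =
        if d = Finsupp.equivFunOnFinite.symm (fun _ => 2) then f.coeff d else 0 := by
    intro d hd
    have := sum_prod_leadingWeight_mul_pow d ((le_totalDegree hd).trans hf)
    rw [← mul_boole, ← this, Finset.mul_sum]
    refine Finset.sum_congr rfl fun x _ => ?_
    rw [Finset.prod_mul_distrib]
    ring
  rw [Finset.sum_congr rfl key, Finset.sum_ite_eq' f.support]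
  simp only [mem_support_iff, ite_not, ite_eq_right_iff]
  exact fun h => h.symm

/-- If the weighted sum over the grid `{0, 1, 2} ^ σ` is nonzero, a polynomial of degree at most
`2 |σ|` does not vanish identically on any grid with sides of size `3`. -/
theorem exists_eval_ne_zero_of_sum_grid_ne_zero [DecidableEq σ] (f : MvPolynomial σ ℚ)
    (hf : f.totalDegree ≤ 2 * Fintype.card σ)
    (hsum : ∑ x : σ → Fin 3, (∏ e, leadingWeight (x e)) * eval (fun e => ((x e : ℕ) : ℚ)) f ≠ 0)
    (S : σ → Finset ℚ) (hS : ∀ e, (S e).card = 3) :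
    ∃ y : σ → ℚ, (∀ e, y e ∈ S e) ∧ eval y f ≠ 0 := by
  rw [sum_grid_eq_coeff f hf] at hsum
  have hdeg : (Finsupp.equivFunOnFinite.symm fun _ : σ => 2).degree = 2 * Fintype.card σ := by
    rw [Finsupp.degree_eq_sum]
    simp [mul_comm]
  refine combinatorial_nullstellensatz_exists_eval_nonzero f _ hsum
    (le_antisymm (hf.trans hdeg.ge) (le_totalDegree (mem_support_iff.2 hsum))) S fun e => ?_
  simp [hS]

end Nullstellensatz

/-! ### Algebra of a single column -/

section StateSum

/-- The Levi-Civita symbol on three indices. -/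
def leviCivita (a b c : Fin 3) : ℤ :=
  (((b : ℕ) : ℤ) - (a : ℕ)) * (((c : ℕ) : ℤ) - (b : ℕ)) * (((c : ℕ) : ℤ) - (a : ℕ)) / 2

/-- The transfer matrix of three parallel strands joined by a vertex or a triangle. -/
def strandTransfer : Matrix (Fin 3 → Fin 3) (Fin 3 → Fin 3) ℤ := fun a b =>
  leviCivita (a 1) (b 1) (a 0) * leviCivita (a 2) (b 2) (b 0) -
    leviCivita (a 1) (b 1) (b 0) * leviCivita (a 2) (b 2) (a 0)

/-- The cyclic shift of the three strands. -/
def strandShift (a : Fin 3 → Fin 3) : Fin 3 → Fin 3 := fun s => a (s - 1)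

lemma sum_fin_three_arrow {M : Type*} [AddCommMonoid M] (f : (Fin 3 → Fin 3) → M) :
    ∑ a, f a = ∑ x, ∑ y, ∑ z, f ![x, y, z] := by
  rw [← (Fin.consEquiv fun _ : Fin 3 => Fin 3).sum_comp, Fintype.sum_prod_type]
  refine Finset.sum_congr rfl fun x _ => ?_
  rw [← (Fin.consEquiv fun _ : Fin 2 => Fin 3).sum_comp, Fintype.sum_prod_type]
  refine Finset.sum_congr rfl fun y _ => ?_
  rw [← (Fin.consEquiv fun _ : Fin 1 => Fin 3).sum_comp, Fintype.sum_prod_type]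
  refine Finset.sum_congr rfl fun z _ => ?_
  rw [Fintype.sum_unique]
  congr 1

lemma forall_fin_three_arrow {p : (Fin 3 → Fin 3) → Prop} :
    (∀ a, p a) ↔ ∀ x y z, p ![x, y, z] := by
  refine ⟨fun h _ _ _ => h _, fun h a => ?_⟩
  have := h (a 0) (a 1) (a 2)
  rwa [show ![a 0, a 1, a 2] = a by ext i; fin_cases i <;> rfl] at this

lemma sum_triangle (s : Fin 3 → Fin 3) :
    ∑ t : Fin 3 → Fin 3, ∏ i, leviCivita (s i) (t i) (t (i - 1)) =
      -leviCivita (s 0) (s 1) (s 2) := by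
  revert s
  simp only [sum_fin_three_arrow, forall_fin_three_arrow]
  decide +kernel

/-- Summing over `s 0` first, the contraction of two Levi-Civita symbols forces `(s 1, s 2)` to be
`(a 0, b 0)` with sign `+` or `(b 0, a 0)` with sign `-`. These are the two terms of
`strandTransfer`. -/
lemma sum_spokes (a b : Fin 3 → Fin 3) :
    ∑ s : Fin 3 → Fin 3, (∏ i, leviCivita (a i) (b i) (s i)) * leviCivita (s 0) (s 1) (s 2) =
      strandTransfer a b := by
  revert a b
  simp only [sum_fin_three_arrow, forall_fin_three_arrow]
  decide +kernel

/-- In matrix form `T ^ 2 = P + P ^ 2 - 2`, where `P` is the permutation matrix of `strandShift`. -/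
lemma sum_strandTransfer_mul (a b : Fin 3 → Fin 3) :
    ∑ c, strandTransfer a c * strandTransfer c b =
      (if strandShift a = b then 1 else 0) + (if strandShift (strandShift a) = b then 1 else 0) -
        2 * (if a = b then 1 else 0) := by
  revert a b
  simp only [sum_fin_three_arrow, forall_fin_three_arrow]
  decide +kernel

/-- In matrix form `(1 + P + P ^ 2) T = 0`. With the formula for `T ^ 2` this gives `T ^ 3 = -T - 2
T`. -/
lemma strandTransfer_add_shift (a b : Fin 3 → Fin 3) :
    strandTransfer (strandShift a) b + strandTransfer (strandShift (strandShift a)) b =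
      -strandTransfer a b := by
  revert a b
  simp only [forall_fin_three_arrow]
  decide +kernel

lemma sum_strandTransfer_shift :
    ∑ a, strandTransfer a (strandShift a) = -6 := by
  simp only [sum_fin_three_arrow]
  decide +kernel

lemma strandTransfer_pow_three : strandTransfer ^ 3 = (-3 : ℤ) • strandTransfer := by
  ext a b
  rw [pow_succ, pow_two, Matrix.mul_apply]
  simp only [Matrix.mul_apply, sum_strandTransfer_mul, add_mul, sub_mul, mul_assoc, boole_mul,
    Finset.sum_add_distrib, Finset.sum_sub_distrib, ← Finset.mul_sum, Finset.sum_ite_eq,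
    mem_univ, if_true, Matrix.smul_apply, smul_eq_mul, strandTransfer_add_shift]
  ring

end StateSum

/-! ### Closed walks and the twisted trace -/

section TransferMatrix

/-- The sum over all walks of length `m` with given weight and closing weight `H`. -/
lemma sum_prod_walk_mul {S R : Type*} [Fintype S] [DecidableEq S] [CommRing R] (M : Matrix S S R)
    (m : ℕ) (H : S → S → R) :
    ∑ a : Fin (m + 1) → S, (∏ j : Fin m, M (a j.succ) (a j.castSucc)) * H (a 0) (a (Fin.last m)) =
      ∑ x, ∑ z, (M ^ m) z x * H x z := by
  induction m generalizing H with
  | zero =>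
    rw [← (Equiv.funUnique (Fin 1) S).symm.sum_comp]
    simp [Matrix.one_apply]
  | succ m ih =>
    rw [← (Fin.consEquiv fun _ : Fin (m + 2) => S).sum_comp, Fintype.sum_prod_type]
    refine Finset.sum_congr rfl fun x _ => ?_
    -- The first step of the walk is absorbed into the closing weight, which is why `H` is arbitrary
    -- in the induction.
    have h := ih fun y z => M y x * H x z
    calc _ = ∑ a : Fin (m + 1) → S, (∏ j : Fin m, M (a j.succ) (a j.castSucc)) *
          (M (a 0) x * H x (a (Fin.last m))) := by
          refine Finset.sum_congr rfl fun a _ => ?_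
          rw [Fin.prod_univ_succ]
          simp only [Fin.consEquiv_apply, Fin.cons_succ, Fin.castSucc_zero, Fin.cons_zero,
            ← Fin.succ_castSucc, ← Fin.succ_last]
          ring
      _ = _ := by
          rw [h, Finset.sum_comm]
          refine Finset.sum_congr rfl fun z _ => ?_
          rw [pow_succ, Matrix.mul_apply, Finset.sum_mul]
          exact Finset.sum_congr rfl fun y _ => by ring

lemma sum_strandTransfer_sq_shift :
    ∑ a, (strandTransfer ^ 2) a (strandShift a) = 24 := by
  simp only [pow_two, Matrix.mul_apply, sum_strandTransfer_mul]
  simp only [sum_fin_three_arrow]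
  decide +kernel

lemma sum_strandTransfer_pow_shift_ne_zero (m : ℕ) :
    ∑ a, (strandTransfer ^ (m + 1)) a (strandShift a) ≠ 0 := by
  induction m using Nat.twoStepInduction with
  | zero => simp [sum_strandTransfer_shift]
  | one => simp [sum_strandTransfer_sq_shift]
  | more m ih _ =>
    have h : strandTransfer ^ (m + 2 + 1) = (-3 : ℤ) • strandTransfer ^ (m + 1) := by
      rw [show m + 2 + 1 = m + 3 by ring, pow_add, strandTransfer_pow_three, pow_succ,
        Matrix.mul_smul]
    simpa only [h, Matrix.smul_apply, smul_eq_mul, ← Finset.mul_sum, mul_ne_zero_iff] using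
      ⟨by norm_num, ih⟩

/-- The strands entering column `j`. -/
def strandPred {m : ℕ} (a : Fin (m + 1) → Fin 3 → Fin 3) (j : Fin (m + 1)) : Fin 3 → Fin 3 :=
  Fin.cases (strandShift (a (Fin.last m))) (fun i => a i.castSucc) j

lemma sum_prod_strandTransfer_ne_zero (m : ℕ) :
    ∑ a : Fin (m + 1) → Fin 3 → Fin 3, ∏ j, strandTransfer (a j) (strandPred a j) ≠ 0 := by
  have h := sum_prod_walk_mul strandTransfer m fun x z => strandTransfer x (strandShift z)
  rw [Finset.sum_comm] at h
  simp only [← Matrix.mul_apply, ← pow_succ] at h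
  have := sum_strandTransfer_pow_shift_ne_zero m
  rw [← h] at this
  convert this using 3 with a
  rw [Fin.prod_univ_succ, mul_comm]
  rfl

end TransferMatrix

/-! ### Cutting the graph into columns -/

section Columns

variable {k : ℕ}

/-- The vertex of `ℤ/3kℤ` in column `j` on strand `s`. -/
def columnStrand (k : ℕ) (p : Fin k × Fin 3) : ZMod (3 * k) := ((p.1 : ℕ) + k * (p.2 : ℕ) : ℕ)

lemma columnStrand_bijective [NeZero k] : Function.Bijective (columnStrand k) := by
  have hk : 0 < k := Nat.pos_of_ne_zero (NeZero.ne k)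
  have : NeZero (3 * k) := ⟨by positivity⟩
  rw [Fintype.bijective_iff_surjective_and_card]
  refine ⟨fun x => ⟨(⟨x.val % k, Nat.mod_lt _ hk⟩, ⟨x.val / k, ?_⟩), ?_⟩, ?_⟩
  · exact Nat.div_lt_of_lt_mul (by simpa [mul_comm] using x.val_lt)
  · simp only [columnStrand, Nat.mod_add_div]
    exact ZMod.natCast_zmod_val x
  · simp [ZMod.card, mul_comm]

/-- The decomposition of `ℤ/3kℤ` into `k` columns and `3` strands. -/
noncomputable def columnStrandEquiv (k : ℕ) [NeZero k] : Fin k × Fin 3 ≃ ZMod (3 * k) :=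
  Equiv.ofBijective _ columnStrand_bijective

lemma columnStrand_sub_k (j : Fin k) (s : Fin 3) :
    columnStrand k (j, s) - (k : ZMod (3 * k)) = columnStrand k (j, s - 1) := by
  have h : ((3 * k : ℕ) : ZMod (3 * k)) = 0 := ZMod.natCast_self _
  push_cast at h
  fin_cases s <;> simp [columnStrand]
  · linear_combination (-1 : ZMod (3 * k)) * h
  · ring

lemma columnStrand_succ_sub_one {m : ℕ} (j : Fin m) (s : Fin 3) :
    columnStrand (m + 1) (j.succ, s) - 1 = columnStrand (m + 1) (j.castSucc, s) := by
  simp [columnStrand]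
  ring

/-- Going around all columns once changes the strand: this is the source of the twist by
`strandShift`. -/
lemma columnStrand_zero_sub_one {m : ℕ} (s : Fin 3) :
    columnStrand (m + 1) (0, s) - 1 = columnStrand (m + 1) (Fin.last m, s - 1) := by
  rw [← columnStrand_sub_k]
  simp [columnStrand]

/-- Functions on `ℤ/3kℤ` as functions of the column and the strand. -/
noncomputable def columnStrandArrow (k : ℕ) [NeZero k] (α : Type*) :
    (ZMod (3 * k) → α) ≃ (Fin k → Fin 3 → α) :=
  (Equiv.arrowCongr (columnStrandEquiv k).symm (Equiv.refl α)).trans (Equiv.curry _ _ _)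

lemma columnStrandArrow_symm_apply [NeZero k] {α : Type*} (a : Fin k → Fin 3 → α) (j : Fin k)
    (s : Fin 3) : (columnStrandArrow k α).symm a (columnStrand k (j, s)) = a j s := by
  have h : (columnStrandEquiv k).symm (columnStrand k (j, s)) = (j, s) :=
    (columnStrandEquiv k).symm_apply_apply _
  simp [columnStrandArrow, Equiv.arrowCongr, h]

/-- The signed number of edge colourings of `GP(3k, k)` with three colours is nonzero. -/
theorem sum_prod_leviCivita_ne_zero (k : ℕ) [NeZero k] [NeZero (3 * k)] :
    ∑ o : ZMod (3 * k) → Fin 3, ∑ s : ZMod (3 * k) → Fin 3, ∑ t : ZMod (3 * k) → Fin 3,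
      ∏ i, leviCivita (o i) (o (i - 1)) (s i) * leviCivita (s i) (t i) (t (i - k)) ≠ 0 := by
  obtain ⟨m, rfl⟩ := Nat.exists_eq_add_one_of_ne_zero (NeZero.ne k)
  have hpred (a : Fin (m + 1) → Fin 3 → Fin 3) (j : Fin (m + 1)) (s : Fin 3) :
      (columnStrandArrow (m + 1) (Fin 3)).symm a (columnStrand (m + 1) (j, s) - 1) =
        strandPred a j s := by
    induction j using Fin.cases with
    | zero => rw [columnStrand_zero_sub_one, columnStrandArrow_symm_apply]; rfl
    | succ j => rw [columnStrand_succ_sub_one, columnStrandArrow_symm_apply]; rfl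
  have hsum (a b : Fin 3 → Fin 3) :
      ∑ s : Fin 3 → Fin 3, ∑ t : Fin 3 → Fin 3,
        ∏ i, leviCivita (a i) (b i) (s i) * leviCivita (s i) (t i) (t (i - 1)) =
          -strandTransfer a b := by
    simp only [Finset.prod_mul_distrib, ← Finset.mul_sum, sum_triangle, mul_neg,
      Finset.sum_neg_distrib, sum_spokes]
  have hprod (f : Fin (m + 1) → (Fin 3 → Fin 3) → ℤ) :
      ∑ a : Fin (m + 1) → Fin 3 → Fin 3, ∏ j, f j (a j) = ∏ j, ∑ x, f j x := by
    rw [Finset.prod_univ_sum, Fintype.piFinset_univ]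
  rw [← (columnStrandArrow (m + 1) (Fin 3)).symm.sum_comp]
  simp_rw [← (columnStrandArrow (m + 1) (Fin 3)).symm.sum_comp
    (fun s => ∑ t : ZMod (3 * (m + 1)) → Fin 3, _)]
  simp_rw [← (columnStrandArrow (m + 1) (Fin 3)).symm.sum_comp
    (fun t : ZMod (3 * (m + 1)) → Fin 3 => ∏ i, _)]
  simp_rw [← (columnStrandEquiv (m + 1)).prod_comp, Fintype.prod_prod_type, columnStrandEquiv,
    Equiv.ofBijective_apply, columnStrand_sub_k, hpred, columnStrandArrow_symm_apply]
  -- Once the outer colours `o` are fixed, the spokes and inner triangles of different columns are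
  -- independent, so the sum over `s` and `t` factors.
  have hfactor (o : Fin (m + 1) → Fin 3 → Fin 3) :
      ∑ s : Fin (m + 1) → Fin 3 → Fin 3, ∑ t : Fin (m + 1) → Fin 3 → Fin 3, ∏ j, ∏ i,
        leviCivita (o j i) (strandPred o j i) (s j i) *
          leviCivita (s j i) (t j i) (t j (i - 1)) =
        (-1) ^ (m + 1) * ∏ j, strandTransfer (o j) (strandPred o j) := by
    rw [Finset.sum_congr rfl fun s _ => hprod fun j (t : Fin 3 → Fin 3) => ∏ i,
      leviCivita (o j i) (strandPred o j i) (s j i) * leviCivita (s j i) (t i) (t (i - 1))]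
    rw [hprod fun j (s : Fin 3 → Fin 3) => ∑ t : Fin 3 → Fin 3, ∏ i,
      leviCivita (o j i) (strandPred o j i) (s i) * leviCivita (s i) (t i) (t (i - 1))]
    refine (Finset.prod_congr rfl fun j _ => hsum (o j) (strandPred o j)).trans ?_
    rw [Finset.prod_neg, card_univ, Fintype.card_fin]
  rw [Finset.sum_congr rfl fun o _ => hfactor o, ← Finset.mul_sum]
  exact mul_ne_zero (pow_ne_zero _ (by norm_num)) (sum_prod_strandTransfer_ne_zero m)

end Columns

/-! ### From the signed count to list colourings -/

section CubicSystem

open MvPolynomial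

lemma two_mul_leviCivita (a b c : Fin 3) :
    2 * leviCivita a b c =
      (((b : ℕ) : ℤ) - (a : ℕ)) * (((c : ℕ) : ℤ) - (b : ℕ)) * (((c : ℕ) : ℤ) - (a : ℕ)) := by
  revert a b c
  decide +kernel

lemma card_one_of_leviCivita_ne_zero {a b c : Fin 3} (h : leviCivita a b c ≠ 0) :
    (if a = 1 then 1 else 0) + (if b = 1 then 1 else 0) + (if c = 1 then 1 else 0) = 1 := by
  revert a b c
  decide +kernel

lemma totalDegree_vandermonde_le {σ : Type*} (a b c : σ) :
    ((X b - X a) * (X c - X b) * (X c - X a) : MvPolynomial σ ℚ).totalDegree ≤ 3 := by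
  have h (x y : σ) : (X x - X y : MvPolynomial σ ℚ).totalDegree ≤ 1 :=
    (totalDegree_sub _ _).trans (by simp)
  refine (totalDegree_mul _ _).trans (Nat.add_le_add ((totalDegree_mul _ _).trans
    (Nat.add_le_add (h _ _) (h _ _))) (h _ _))

variable {ι : Type*} [Fintype ι]

/-- The graph polynomial of the line graph of the cubic graph with vertices `u i`, `v i` and edges
`o i` (at `u i`), `s i` (from `u i` to `v i`) and `t i` (at `v i`), where `o (p i)` and `t (q i)`
are the further edges at `u i` and `v i`. -/
noncomputable def cubicPolynomial (p q : Equiv.Perm ι) : MvPolynomial (ι ⊕ ι ⊕ ι) ℚ :=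
  ∏ i, ((X (.inl (p i)) - X (.inl i)) * (X (.inr (.inl i)) - X (.inl (p i))) *
      (X (.inr (.inl i)) - X (.inl i))) *
    ((X (.inr (.inr i)) - X (.inr (.inl i))) * (X (.inr (.inr (q i))) - X (.inr (.inr i))) *
      (X (.inr (.inr (q i))) - X (.inr (.inl i))))

lemma totalDegree_cubicPolynomial_le (p q : Equiv.Perm ι) :
    (cubicPolynomial p q).totalDegree ≤ 2 * Fintype.card (ι ⊕ ι ⊕ ι) := by
  refine (totalDegree_finsetProd _ _).trans ((Finset.sum_le_card_nsmul _ _ 6 fun i _ => ?_).trans ?_)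
  · exact (totalDegree_mul _ _).trans
      (Nat.add_le_add (totalDegree_vandermonde_le _ _ _) (totalDegree_vandermonde_le _ _ _))
  · simp only [card_univ, Fintype.card_sum, smul_eq_mul]
    omega

lemma eval_cubicPolynomial (p q : Equiv.Perm ι) (x : ι ⊕ ι ⊕ ι → Fin 3) :
    eval (fun e => ((x e : ℕ) : ℚ)) (cubicPolynomial p q) = 4 ^ Fintype.card ι *
      ((∏ i, leviCivita (x (.inl i)) (x (.inl (p i))) (x (.inr (.inl i))) *
        leviCivita (x (.inr (.inl i))) (x (.inr (.inr i))) (x (.inr (.inr (q i)))) : ℤ) : ℚ) := by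
  have h (a b c : Fin 3) : (((b : ℕ) : ℚ) - (a : ℕ)) * (((c : ℕ) : ℚ) - (b : ℕ)) *
      (((c : ℕ) : ℚ) - (a : ℕ)) = 2 * (leviCivita a b c : ℚ) := by
    exact_mod_cast (two_mul_leviCivita a b c).symm
  rw [cubicPolynomial, eval_prod, ← card_univ, ← Finset.prod_const, Int.cast_prod,
    ← Finset.prod_mul_distrib]
  refine Finset.prod_congr rfl fun i _ => ?_
  simp only [map_mul, map_sub, eval_X, h, Int.cast_mul]
  ring

/-- Colour 1 occurs exactly once at each of the `2 |ι|` vertices and each edge has two ends, so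
exactly `|ι|` edges have colour 1. -/
lemma prod_leadingWeight (p q : Equiv.Perm ι) (x : ι ⊕ ι ⊕ ι → Fin 3)
    (hx : ∏ i, leviCivita (x (.inl i)) (x (.inl (p i))) (x (.inr (.inl i))) *
      leviCivita (x (.inr (.inl i))) (x (.inr (.inr i))) (x (.inr (.inr (q i)))) ≠ 0) :
    ∏ e, leadingWeight (x e) =
      (1 / 2) ^ Fintype.card (ι ⊕ ι ⊕ ι) * (-2) ^ Fintype.card ι := by
  simp only [leadingWeight]
  rw [Finset.prod_mul_distrib, Finset.prod_const, card_univ, Finset.prod_pow_eq_pow_sum]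
  congr 2
  rw [Finset.prod_ne_zero_iff] at hx
  have ho : ∑ i, (((if x (.inl i) = 1 then 1 else 0) + (if x (.inl (p i)) = 1 then 1 else 0)) +
      (if x (.inr (.inl i)) = 1 then 1 else 0)) = ∑ _i : ι, 1 :=
    Finset.sum_congr rfl fun i hi =>
      card_one_of_leviCivita_ne_zero (left_ne_zero_of_mul (hx i hi))
  have ht : ∑ i, (((if x (.inr (.inl i)) = 1 then 1 else 0) +
      (if x (.inr (.inr i)) = 1 then 1 else 0)) +
      (if x (.inr (.inr (q i))) = 1 then 1 else 0)) = ∑ _i : ι, 1 :=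
    Finset.sum_congr rfl fun i hi =>
      card_one_of_leviCivita_ne_zero (right_ne_zero_of_mul (hx i hi))
  simp only [Finset.sum_add_distrib] at ho ht
  rw [Equiv.sum_comp p fun i => if x (.inl i) = 1 then (1 : ℕ) else 0] at ho
  rw [Equiv.sum_comp q fun i => if x (.inr (.inr i)) = 1 then (1 : ℕ) else 0] at ht
  rw [Finset.sum_const, card_univ, smul_eq_mul, mul_one] at ho ht
  rw [Fintype.sum_sum_type, Fintype.sum_sum_type]
  omega

variable [DecidableEq ι]

lemma sum_grid_cubicPolynomial_ne_zero (p q : Equiv.Perm ι)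
    (h : ∑ o : ι → Fin 3, ∑ s : ι → Fin 3, ∑ t : ι → Fin 3,
      ∏ i, leviCivita (o i) (o (p i)) (s i) * leviCivita (s i) (t i) (t (q i)) ≠ 0) :
    ∑ x : ι ⊕ ι ⊕ ι → Fin 3, (∏ e, leadingWeight (x e)) *
      eval (fun e => ((x e : ℕ) : ℚ)) (cubicPolynomial p q) ≠ 0 := by
  have key (x : ι ⊕ ι ⊕ ι → Fin 3) : (∏ e, leadingWeight (x e)) *
      eval (fun e => ((x e : ℕ) : ℚ)) (cubicPolynomial p q) =
      ((1 / 2) ^ Fintype.card (ι ⊕ ι ⊕ ι) * (-2) ^ Fintype.card ι * 4 ^ Fintype.card ι) *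
      ((∏ i, leviCivita (x (.inl i)) (x (.inl (p i))) (x (.inr (.inl i))) *
        leviCivita (x (.inr (.inl i))) (x (.inr (.inr i))) (x (.inr (.inr (q i)))) : ℤ) : ℚ) := by
    rw [eval_cubicPolynomial]
    by_cases hx : ∏ i, leviCivita (x (.inl i)) (x (.inl (p i))) (x (.inr (.inl i))) *
        leviCivita (x (.inr (.inl i))) (x (.inr (.inr i))) (x (.inr (.inr (q i)))) = 0
    · simp only [hx, Int.cast_zero, mul_zero]
    · rw [prod_leadingWeight p q x hx]
      ring
  simp only [key]
  rw [← Finset.mul_sum, ← Int.cast_sum]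
  refine mul_ne_zero (by positivity) (Int.cast_ne_zero.2 ?_)
  rw [← (Equiv.sumArrowEquivProdArrow _ _ _).symm.sum_comp, Fintype.sum_prod_type]
  convert h using 3 with o
  rw [← (Equiv.sumArrowEquivProdArrow _ _ _).symm.sum_comp, Fintype.sum_prod_type]
  rfl

/-- If the signed number of edge colourings with three colours of a cubic graph is nonzero, the
graph is edge-colourable from lists of size `3`. -/
theorem exists_list_colouring_of_sum_ne_zero (p q : Equiv.Perm ι)
    (h : ∑ o : ι → Fin 3, ∑ s : ι → Fin 3, ∑ t : ι → Fin 3,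
      ∏ i, leviCivita (o i) (o (p i)) (s i) * leviCivita (s i) (t i) (t (q i)) ≠ 0)
    {C : Type*} (L : ι ⊕ ι ⊕ ι → Finset C) (hL : ∀ e, (L e).card = 3) :
    ∃ c : ι ⊕ ι ⊕ ι → C, (∀ e, c e ∈ L e) ∧ ∀ i,
      c (.inl (p i)) ≠ c (.inl i) ∧ c (.inr (.inl i)) ≠ c (.inl (p i)) ∧
      c (.inr (.inl i)) ≠ c (.inl i) ∧ c (.inr (.inr i)) ≠ c (.inr (.inl i)) ∧
      c (.inr (.inr (q i))) ≠ c (.inr (.inr i)) ∧ c (.inr (.inr (q i))) ≠ c (.inr (.inl i)) := by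
  classical
  -- Only finitely many colours occur in the lists, so they can be encoded injectively as rational
  -- numbers.
  obtain ⟨g, hg⟩ := Set.countable_iff_exists_injOn.1 (univ.biUnion L).countable_toSet
  have hinj (e : ι ⊕ ι ⊕ ι) : Set.InjOn (fun x => (g x : ℚ)) (L e) := fun x hx y hy hxy =>
    hg (mem_biUnion.2 ⟨e, mem_univ e, hx⟩) (mem_biUnion.2 ⟨e, mem_univ e, hy⟩)
      (Nat.cast_injective hxy)
  obtain ⟨y, hy, hne⟩ := exists_eval_ne_zero_of_sum_grid_ne_zero (cubicPolynomial p q)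
    (totalDegree_cubicPolynomial_le p q) (sum_grid_cubicPolynomial_ne_zero p q h)
    (fun e => (L e).image fun x => (g x : ℚ))
    (fun e => by rw [card_image_of_injOn (hinj e), hL])
  choose c hc hcy using fun e => mem_image.1 (hy e)
  refine ⟨c, hc, fun i => ?_⟩
  rw [cubicPolynomial, eval_prod, Finset.prod_ne_zero_iff] at hne
  have hi := hne i (mem_univ i)
  simp only [map_mul, map_sub, eval_X, mul_ne_zero_iff, sub_ne_zero, ← hcy] at hi
  obtain ⟨⟨⟨h₁, h₂⟩, h₃⟩, ⟨h₄, h₅⟩, h₆⟩ := hi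
  exact ⟨fun e => h₁ (by rw [e]), fun e => h₂ (by rw [e]), fun e => h₃ (by rw [e]),
    fun e => h₄ (by rw [e]), fun e => h₅ (by rw [e]), fun e => h₆ (by rw [e])⟩

end CubicSystem

/-! ### The generalised Petersen graph and the two indices -/

namespace SimpleGraph

variable {k : ℕ}

lemma one_ne_zero_zmod_three_mul (hk : 1 ≤ k) : (1 : ZMod (3 * k)) ≠ 0 := by
  have : Fact (1 < 3 * k) := ⟨by omega⟩
  exact one_ne_zero

lemma natCast_ne_zero_zmod_three_mul (hk : 1 ≤ k) : (k : ZMod (3 * k)) ≠ 0 := by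
  rw [Ne, ZMod.natCast_eq_zero_iff]
  exact fun h => absurd (Nat.le_of_dvd hk h) (by omega)

/-- The edges of `GP(3k, k)`: `u i u (i + 1)`, `u i v i` and `v i v (i + k)`. -/
def generalizedPetersenEdge (hk : 1 ≤ k) :
    ZMod (3 * k) ⊕ ZMod (3 * k) ⊕ ZMod (3 * k) → (generalizedPetersen (3 * k) k).edgeSet
  | .inl i => ⟨s(.inl i, .inl (i + 1)), by
      simp only [generalizedPetersen, edgeSet_fromEdgeSet]
      exact ⟨⟨i, .inl rfl⟩, by simpa [Sym2.mem_diagSet] using one_ne_zero_zmod_three_mul hk⟩⟩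
  | .inr (.inl i) => ⟨s(.inl i, .inr i), by
      simp only [generalizedPetersen, edgeSet_fromEdgeSet]
      exact ⟨⟨i, .inr (.inl rfl)⟩, by simp [Sym2.mem_diagSet]⟩⟩
  | .inr (.inr i) => ⟨s(.inr i, .inr (i + k)), by
      simp only [generalizedPetersen, edgeSet_fromEdgeSet]
      exact ⟨⟨i, .inr (.inr rfl)⟩, by
        simpa [Sym2.mem_diagSet] using natCast_ne_zero_zmod_three_mul hk⟩⟩

lemma generalizedPetersenEdge_surjective (hk : 1 ≤ k) :
    Function.Surjective (generalizedPetersenEdge hk) := by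
  rintro ⟨e, he⟩
  simp only [generalizedPetersen, edgeSet_fromEdgeSet] at he
  obtain ⟨⟨i, rfl | rfl | rfl⟩, -⟩ := he
  exacts [⟨.inl i, rfl⟩, ⟨.inr (.inl i), rfl⟩, ⟨.inr (.inr i), rfl⟩]

lemma inl_mem_generalizedPetersenEdge (hk : 1 ≤ k) {i : ZMod (3 * k)}
    {e : ZMod (3 * k) ⊕ ZMod (3 * k) ⊕ ZMod (3 * k)}
    (h : Sum.inl i ∈ (generalizedPetersenEdge hk e : Sym2 (ZMod (3 * k) ⊕ ZMod (3 * k)))) :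
    e = .inl i ∨ e = .inl (i - 1) ∨ e = .inr (.inl i) := by
  rcases e with j | j | j <;> simp [generalizedPetersenEdge] at h ⊢
  · exact h.imp Eq.symm fun h => by rw [h]; ring
  · exact h.symm

lemma inr_mem_generalizedPetersenEdge (hk : 1 ≤ k) {i : ZMod (3 * k)}
    {e : ZMod (3 * k) ⊕ ZMod (3 * k) ⊕ ZMod (3 * k)}
    (h : Sum.inr i ∈ (generalizedPetersenEdge hk e : Sym2 (ZMod (3 * k) ⊕ ZMod (3 * k)))) :
    e = .inr (.inl i) ∨ e = .inr (.inr i) ∨ e = .inr (.inr (i - k)) := by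
  rcases e with j | j | j <;> simp [generalizedPetersenEdge] at h ⊢
  · exact h.symm
  · exact h.imp Eq.symm fun h => by rw [h]; ring

theorem edgeChoosable_generalizedPetersen (hk : 1 ≤ k) :
    (generalizedPetersen (3 * k) k).EdgeChoosable 3 := by
  intro C L hL
  have : NeZero k := ⟨by omega⟩
  have : NeZero (3 * k) := ⟨by omega⟩
  obtain ⟨c, hc, hne⟩ := exists_list_colouring_of_sum_ne_zero (Equiv.subRight (1 : ZMod (3 * k)))
    (Equiv.subRight (k : ZMod (3 * k))) (sum_prod_leviCivita_ne_zero k)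
    (fun e => L (generalizedPetersenEdge hk e)) (fun e => hL _)
  simp only [Equiv.subRight_apply] at hne
  have hsurj := Function.surjInv_eq (generalizedPetersenEdge_surjective hk)
  refine ⟨Coloring.mk (fun e => c (Function.surjInv (generalizedPetersenEdge_surjective hk) e))
    fun {e f} hadj => ?_, fun e => ?_⟩
  · obtain ⟨hef, w, hwe, hwf⟩ := hadj
    have hne' : Function.surjInv (generalizedPetersenEdge_surjective hk) e ≠
        Function.surjInv (generalizedPetersenEdge_surjective hk) f := fun h =>
      hef ((Function.injective_surjInv _) h)
    rw [← hsurj e] at hwe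
    rw [← hsurj f] at hwf
    generalize Function.surjInv (generalizedPetersenEdge_surjective hk) e = e' at *
    generalize Function.surjInv (generalizedPetersenEdge_surjective hk) f = f' at *
    rcases w with i | i
    · obtain ⟨h₁, h₂, h₃, -⟩ := hne i
      rcases inl_mem_generalizedPetersenEdge hk hwe with rfl | rfl | rfl <;>
        rcases inl_mem_generalizedPetersenEdge hk hwf with rfl | rfl | rfl <;>
        first | exact absurd rfl hne' | assumption | (apply Ne.symm; assumption)
    · obtain ⟨-, -, -, h₁, h₂, h₃⟩ := hne i
      rcases inr_mem_generalizedPetersenEdge hk hwe with rfl | rfl | rfl <;>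
        rcases inr_mem_generalizedPetersenEdge hk hwf with rfl | rfl | rfl <;>
        first | exact absurd rfl hne' | assumption | (apply Ne.symm; assumption)
  · have := hc (Function.surjInv (generalizedPetersenEdge_surjective hk) e)
    rwa [hsurj e] at this

/-- Ordinary colouring is the case of equal lists. -/
lemma EdgeChoosable.colorable_lineGraph {V : Type} {G : SimpleGraph V} {l : ℕ}
    (h : G.EdgeChoosable l) : G.lineGraph.Colorable l := by
  obtain ⟨c, -⟩ := h (Fin l) (fun _ => univ) fun _ => by simp
  exact ⟨c⟩

lemma EdgeChoosable.chromaticIndex_le {V : Type} {G : SimpleGraph V} {l : ℕ}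
    (h : G.EdgeChoosable l) : G.chromaticIndex ≤ l :=
  h.colorable_lineGraph.chromaticNumber_le

lemma three_le_chromaticIndex_generalizedPetersen (hk : 1 ≤ k) :
    3 ≤ (generalizedPetersen (3 * k) k).chromaticIndex := by
  classical
  have h1 := one_ne_zero_zmod_three_mul hk
  -- This separates the outer edges from `u 0` to `u 1` and to `u (-1)`. With the spoke at `u 0`
  -- they form a triangle in the line graph.
  have h2 : (2 : ZMod (3 * k)) ≠ 0 := by
    have : ((2 : ℕ) : ZMod (3 * k)) ≠ 0 := by
      rw [Ne, ZMod.natCast_eq_zero_iff]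
      exact fun h => absurd (Nat.le_of_dvd two_pos h) (by omega)
    exact_mod_cast this
  let e : Fin 3 → (generalizedPetersen (3 * k) k).edgeSet := fun j =>
    generalizedPetersenEdge hk (![.inl 0, .inl (-1), .inr (.inl 0)] j)
  have h01 : e 0 ≠ e 1 := by
    simp [e, generalizedPetersenEdge, Subtype.ext_iff, h1]
    intro h
    exact absurd (by linear_combination h) h2
  have h02 : e 0 ≠ e 2 := by simp [e, generalizedPetersenEdge, Subtype.ext_iff]
  have h12 : e 1 ≠ e 2 := by simp [e, generalizedPetersenEdge, Subtype.ext_iff]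
  have hmem (j : Fin 3) :
      Sum.inl 0 ∈ (e j : Sym2 (ZMod (3 * k) ⊕ ZMod (3 * k))) := by
    fin_cases j <;> simp [e, generalizedPetersenEdge]
  have hclique : (generalizedPetersen (3 * k) k).lineGraph.IsClique
      (({e 0, e 1, e 2} : Finset _) : Set (generalizedPetersen (3 * k) k).edgeSet) := by
    intro a ha b hb hab
    refine ⟨hab, Sum.inl 0, ?_, ?_⟩
    · simp only [coe_insert, coe_singleton, Set.mem_insert_iff, Set.mem_singleton_iff] at ha
      rcases ha with rfl | rfl | rfl <;> exact hmem _
    · simp only [coe_insert, coe_singleton, Set.mem_insert_iff, Set.mem_singleton_iff] at hb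
      rcases hb with rfl | rfl | rfl <;> exact hmem _
  have := hclique.card_le_chromaticNumber
  rwa [card_eq_three.2 ⟨_, _, _, h01, h02, h12, rfl⟩] at this

end SimpleGraph

theorem theorem2 (k : ℕ) (hk : 1 ≤ k) :
    (SimpleGraph.generalizedPetersen (3 * k) k).choiceIndex =
        (SimpleGraph.generalizedPetersen (3 * k) k).chromaticIndex ∧
      (SimpleGraph.generalizedPetersen (3 * k) k).chromaticIndex = 3 := by
  have hch := SimpleGraph.edgeChoosable_generalizedPetersen hk
  have hindex : (SimpleGraph.generalizedPetersen (3 * k) k).chromaticIndex = 3 :=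
    le_antisymm hch.chromaticIndex_le (SimpleGraph.three_le_chromaticIndex_generalizedPetersen hk)
  refine ⟨le_antisymm ?_ (le_iInf₂ fun l hl => hl.chromaticIndex_le), hindex⟩
  rw [hindex]
  exact iInf₂_le_of_le 3 hch le_rfl
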